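/- Let $G=(V,E)$ be a finite simple graph with $n\ge 1$ vertices and adjacency matrix $A$, let $\lambda_1\ge\cdots\ge\lambda_n$ be the eigenvalues of $A$ with multiplicity, let $k\ge 1$ be an integer, and let $p\in\mathbb{R}[x]$ have degree at most $k$. Put $W(p)=\max_{u\in V}(p(A))_{uu}$ and $w(p)=\min_{u\in V}(p(A))_{uu}$. A quantum $k$-distance $c$-coloring of $G$ by (possibly infinite-dimensional) projectors is a family of orthogonal projectors $\{P_{v,h}: v\in V,\ h\in\{1,\dots,c\}\}$ on a complex Hilbert space $H$ of arbitrary dimension, such that 1. $\sum_{h=1}^{c}P_{v,h}=I$ for every $v\in V$; 2. $P_{v,h}P_{w,h}=0$ for every $h$ and all distinct $v,w\in V$ at distance at most $k$ in $G$; 3. the unital $*$-algebra generated by the $P_{v,h}$ has a tracial state, that is, a linear functional $\tau$ with $\tau(I)=1$, $\tau(x^*x)\ge 0$ and $\tau(xy)=\tau(yx)$ for all $x,y$ in it. (If $0<\dim H<\infty$, condition 3 holds automatically, by the normalized trace.) Let $\chi_{kq}(G)$ be the smallest $c$ for which such a coloring exists on some $H$. Then the denominator below is positive and $$\chi_{kq}(G)\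 \ge\ \frac{n}{\min\{\,|\{i: p(\lambda_i)\ge w(p)\}|,\ |\{i: p(\lambda_i)\le W(p)\}|\,\}}.$$ -/

import Mathlib

universe u v

open scoped ComplexOrder in
/-- A tracial state on a unital complex `*`-algebra: a linear functional that is positive,
takes the value `1` at the unit, and is invariant under cyclic permutations. On the algebra of
`d × d` matrices it is the normalized trace. -/
structure IsTracialState {A : Type*} [Ring A] [StarRing A] [Algebra ℂ A] (τ : A →ₗ[ℂ] ℂ) :
    Prop where
  map_one : τ 1 = 1
  nonneg : ∀ x : A, 0 ≤ τ (star x * x)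
  comm : ∀ x y : A, τ (x * y) = τ (y * x)

/-- A quantum `k`-distance `c`-coloring of `G` by orthogonal projectors on a complex Hilbert space
`H` of arbitrary, possibly infinite, dimension. In the matrix case `H = ℂ^d` the field
`tracial` holds automatically, by the normalized trace; in infinite dimension it is
the condition of the commuting operator (tracial) framework. It is required only on the unital
`*`-algebra generated by the projectors. -/
structure IsQuantumDistColoring {V : Type v} (G : SimpleGraph V) (k c : ℕ)
    {H : Type u} [NormedAddCommGroup H] [InnerProductSpace ℂ H] [CompleteSpace H]
    (P : V → Fin c → (H →L[ℂ] H)) : Prop where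
  proj : ∀ x h, IsStarProjection (P x h)
  complete : ∀ x, ∑ h, P x h = 1
  orthogonal : ∀ x y, x ≠ y → G.edist x y ≤ k → ∀ h, P x h * P y h = 0
  tracial : ∃ τ : StarAlgebra.adjoin ℂ {T : H →L[ℂ] H | ∃ x h, T = P x h} →ₗ[ℂ] ℂ,
    IsTracialState τ

/-- `G` admits a quantum `k`-distance `c`-coloring on some Hilbert space. The space is nonzero
since a tracial state takes the value `1` at the identity. -/
def HasQuantumDistColoring {V : Type v} (G : SimpleGraph V) (k c : ℕ) : Prop :=
  ∃ (H : Type u) (_ : NormedAddCommGroup H) (_ : InnerProductSpace ℂ H) (_ : CompleteSpace H)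
    (P : V → Fin c → (H →L[ℂ] H)), IsQuantumDistColoring G k c P

/-- The quantum `k`-distance chromatic number over Hilbert spaces of arbitrary dimension: the
least `c` for which a quantum `k`-distance `c`-coloring exists. -/
noncomputable def quantumDistChromaticNumber {V : Type v} (G : SimpleGraph V) (k : ℕ) : ℕ :=
  sInf {c : ℕ | HasQuantumDistColoring.{u} G k c}

section Spectral

variable {V : Type v} [Fintype V] [DecidableEq V] (G : SimpleGraph V) [DecidableRel G.Adj]

/-- The eigenvalues of the adjacency matrix, listed with multiplicity. -/
noncomputable def adjEigenvalues : V → ℝ :=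
  Matrix.IsHermitian.eigenvalues (A := G.adjMatrix ℝ)
    ((Matrix.conjTranspose_eq_transpose_of_trivial _).trans G.transpose_adjMatrix)

/-- `W(p)`, the largest diagonal entry of `p(A)`. -/
noncomputable def maxDiag (p : Polynomial ℝ) : ℝ :=
  ⨆ x : V, (Polynomial.aeval (G.adjMatrix ℝ) p) x x

/-- `w(p)`, the smallest diagonal entry of `p(A)`. -/
noncomputable def minDiag (p : Polynomial ℝ) : ℝ :=
  ⨅ x : V, (Polynomial.aeval (G.adjMatrix ℝ) p) x x

/-- `min { #{i : p(λᵢ) ≥ w(p)}, #{i : p(λᵢ) ≤ W(p)} }`. -/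
noncomputable def inertiaCount (p : Polynomial ℝ) : ℕ :=
  min (Nat.card {i : V // minDiag G p ≤ p.eval (adjEigenvalues G i)})
    (Nat.card {i : V // p.eval (adjEigenvalues G i) ≤ maxDiag G p})

end Spectral

/-! Put `B = p(A) - w(p)`, or `W(p) - p(A)`: its diagonal is nonnegative and it vanishes beyond
distance `k`. For one color let `P` be the diagonal matrix of its projectors and `F` the spectral
projection of `B` onto eigenvalues `≥ 0`. Orthogonality makes `P B P` diagonal and positive, so `P`
should be no larger in trace than `F`; summing over colors gives `n ≤ c · rank F`.

With only a trace on a `*`-algebra, ranks and polar decompositions are replaced by a limit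
(`tracial_projection_le`). For `a = P(1 - F)P` and `b = F(1 - P)F`, the difference `T(b^m F) - T(a^m
P)` is independent of `m`; its first term is nonnegative, and the second decays geometrically thanks
to the spectral gap of `B`. -/

/-! ### Comparison of two projections under a trace -/

/-- Powers of the compression `P (1 - F) P = P - P F P`, cut down to the corner of `P`, are
squares. -/
theorem exists_star_mul_self_eq_compression_pow {R : Type*} [Ring R] [StarRing R] {P F : R}
    (hPP : P * P = P) (hFF : F * F = F) (hPs : star P = P) (hFs : star F = F) (m : ℕ) :
    ∃ g, (P - P * F * P) ^ m * P = star g * g := by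
  have haP : Commute (P - P * F * P) P := by
    simp only [Commute, SemiconjBy, sub_mul, mul_sub, mul_assoc, hPP]
    simp only [← mul_assoc, hPP]
  have has : star (P - P * F * P) = P - P * F * P := by simp [hPs, hFs, mul_assoc]
  have hE : P * ((1 - F) * (1 - F)) * P = P - P * F * P := by
    have : (1 - F) * (1 - F) = 1 - F := by simp [sub_mul, mul_sub, hFF]
    rw [this, mul_sub, sub_mul, mul_one, hPP]
  rcases Nat.even_or_odd' m with ⟨j, rfl | rfl⟩
  · refine ⟨(P - P * F * P) ^ j * P, ?_⟩
    rw [star_mul, star_pow, has, hPs, two_mul, pow_add, ← (haP.pow_left j).eq,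
      mul_assoc, mul_assoc (_ ^ j) P, ← mul_assoc P, ← (haP.pow_left j).eq, mul_assoc _ P P, hPP]
  · refine ⟨(1 - F) * P * (P - P * F * P) ^ j, ?_⟩
    rw [star_mul, star_mul, star_pow, has, hPs, star_sub, star_one, hFs]
    have : (P - P * F * P) ^ j * (P * (1 - F)) * ((1 - F) * P * (P - P * F * P) ^ j) =
      (P - P * F * P) ^ j * (P * ((1 - F) * (1 - F)) * P) * (P - P * F * P) ^ j := by
      simp only [mul_assoc]
    rw [this, hE, ← pow_succ, ← pow_add, show j + 1 + j = 2 * j + 1 by ring, pow_succ, mul_assoc]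
    congr 1
    simp only [sub_mul, mul_assoc, hPP]

/-- If `P`, `F` are projections and `P (M F - δ (1 - F)) P` is a sum of two squares with `δ > 0`,
then `P` is at most as large as `F` in every positive tracial functional. -/
theorem tracial_projection_le {R : Type*} [Ring R] [StarRing R] [Algebra ℝ R]
    (T : R →ₗ[ℝ] ℝ) (hpos : ∀ x, 0 ≤ T (star x * x)) (hcomm : ∀ x y, T (x * y) = T (y * x))
    {P F : R} (hP : IsStarProjection P) (hF : IsStarProjection F) {M δ : ℝ} (hM : 0 ≤ M)
    (hδ : 0 < δ) {y z : R}
    (h : M • P - (M + δ) • (P - P * F * P) = star y * y + star z * z) : T P ≤ T F := by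
  have hPP : P * P = P := hP.isIdempotentElem
  have hFF : F * F = F := hF.isIdempotentElem
  have hPs : star P = P := hP.isSelfAdjoint
  have hFs : star F = F := hF.isSelfAdjoint
  set a := P - P * F * P with ha
  set b := F - F * P * F with hb
  -- Both `F P a` and `b F P` equal `F P - F P F P`.
  have hinter : ∀ m : ℕ, F * P * a ^ m = b ^ m * (F * P) := by
    have h1 : SemiconjBy (F * P) a b := by
      simp only [SemiconjBy, ha, hb, sub_mul, mul_sub]
      simp only [mul_assoc]
      rw [← mul_assoc P P, ← mul_assoc F F, hPP, hFF]
    exact fun m => (h1.pow_right m).eq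
  have haP : a * P = a := by simp only [ha, sub_mul, mul_assoc, hPP]
  have hbF : b * F = b := by simp only [hb, sub_mul, mul_assoc, hFF]
  -- Raising `m` by one lowers both traces by the same amount, by cyclicity.
  have hconst : ∀ m : ℕ, T (b ^ m * F) - T (a ^ m * P) = T F - T P := by
    intro m
    induction m with
    | zero => simp
    | succ m ih =>
      have e1 : b ^ (m + 1) * F = b ^ m * F - F * P * a ^ m * (P * F) := by
        rw [hinter, pow_succ, mul_assoc, hbF, hb, mul_sub]
        simp only [mul_assoc]
        rw [← mul_assoc P P, hPP]
      have e2 : a ^ (m + 1) * P = a ^ m * P - a ^ m * (P * F * P) := by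
        rw [pow_succ, mul_assoc, haP, ha, mul_sub]
      have e3 : T (F * P * a ^ m * (P * F)) = T (a ^ m * (P * F * P)) := by
        rw [mul_assoc, hcomm, mul_assoc]
        congr 2
        simp only [mul_assoc]
        rw [← mul_assoc F F, hFF]
      rw [e1, e2, map_sub, map_sub, e3]
      linarith
  have hb0 : ∀ m : ℕ, 0 ≤ T (b ^ m * F) := fun m => by
    obtain ⟨g, hg⟩ := exists_star_mul_self_eq_compression_pow hFF hPP hFs hPs m
    rw [hb, hg]; exact hpos g
  have hpp : ∀ g y : R, 0 ≤ T (star g * g * (star y * y)) := fun g y => by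
    have := hpos (y * star g)
    rwa [star_mul, star_star, ← mul_assoc, ← hcomm, ← mul_assoc, ← mul_assoc, mul_assoc] at this
  -- Pair `h` with the square `a ^ m * P`: the trace of a product of two squares is nonnegative.
  have hdecay : ∀ m : ℕ, (M + δ) * T (a ^ (m + 1) * P) ≤ M * T (a ^ m * P) := by
    intro m
    obtain ⟨g, hg⟩ := exists_star_mul_self_eq_compression_pow hPP hFF hPs hFs m
    have h1 : 0 ≤ T (a ^ m * P * (M • P - (M + δ) • a)) := by
      rw [h, mul_add, map_add, ha, hg]
      exact add_nonneg (hpp _ _) (hpp _ _)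
    have h2 : a ^ m * P * (M • P - (M + δ) • a)
        = M • (a ^ m * P) - (M + δ) • (a ^ (m + 1) * P) := by
      have hPa : P * a = a := by simp only [ha, mul_sub, ← mul_assoc, hPP]
      rw [mul_sub, mul_smul_comm, mul_smul_comm, mul_assoc, mul_assoc, hPP, hPa, pow_succ,
        mul_assoc, haP]
    rw [h2, map_sub, map_smul, map_smul, smul_eq_mul, smul_eq_mul] at h1
    linarith
  have hMδ : 0 < M + δ := by linarith
  have hpow : ∀ m : ℕ, T (a ^ m * P) ≤ (M / (M + δ)) ^ m * T P := by
    intro m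
    induction m with
    | zero => simp
    | succ m ih =>
      have h1 : T (a ^ (m + 1) * P) ≤ M / (M + δ) * T (a ^ m * P) := by
        rw [div_mul_eq_mul_div, le_div_iff₀ hMδ, mul_comm]
        exact hdecay m
      refine h1.trans ?_
      rw [pow_succ', mul_assoc]
      gcongr
  have hlim : Filter.Tendsto (fun m : ℕ => (M / (M + δ)) ^ m * T P) Filter.atTop (nhds 0) := by
    simpa using (tendsto_pow_atTop_nhds_zero_of_lt_one (by positivity)
      ((div_lt_one hMδ).2 (by linarith))).mul_const (T P)
  have : T P - T F ≤ 0 := ge_of_tendsto' hlim fun m => by linarith [hb0 m, hconst m, hpow m]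
  linarith

open Matrix

/-! ### Inertia bound over matrices with entries in the algebra -/

/-- Inertia bound: for a real symmetric matrix `B = U diag(μ) Uᵀ` with nonnegative diagonal and
projections `q` such that `q x * q y = 0` wherever `B` has a nonzero off-diagonal entry, the total
trace of `q` is at most the number of nonnegative eigenvalues of `B`. -/
theorem sum_tracial_le_card_nonneg {V : Type*} [Fintype V] [DecidableEq V]
    {𝒜 : Type*} [Ring 𝒜] [StarRing 𝒜] [Algebra ℝ 𝒜] [StarModule ℝ 𝒜]
    (τ : 𝒜 →ₗ[ℝ] ℝ) (hone : τ 1 = 1) (hpos : ∀ x, 0 ≤ τ (star x * x))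
    (hcomm : ∀ x y, τ (x * y) = τ (y * x))
    (U : unitaryGroup V ℝ) (μ : V → ℝ) (B : Matrix V V ℝ)
    (hB : B = Unitary.conjStarAlgAut ℝ _ U (diagonal μ)) (hdiag : ∀ x, 0 ≤ B x x)
    (q : V → 𝒜) (hq : ∀ x, IsStarProjection (q x))
    (horth : ∀ x y, x ≠ y → B x y ≠ 0 → q x * q y = 0) :
    ∑ x, τ (q x) ≤ Nat.card {i // 0 ≤ μ i} := by
  classical
  let f : Matrix V V ℝ →ₐ[ℝ] Matrix V V 𝒜 := (Algebra.ofId ℝ 𝒜).mapMatrix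
  have hf : ∀ X x y, f X x y = algebraMap ℝ 𝒜 (X x y) := fun X x y => rfl
  have hfstar : ∀ X, star (f X) = f (star X) := by
    intro X
    ext x y
    simp [star_apply, hf, ← algebraMap_star_comm]
  let T : Matrix V V 𝒜 →ₗ[ℝ] ℝ := τ ∘ₗ traceLinearMap V ℝ 𝒜
  have hT : ∀ X, T X = ∑ x, τ (X x x) := fun X => by simp [T, trace]
  have hTpos : ∀ X, 0 ≤ T (star X * X) := fun X => by
    rw [hT]
    refine Finset.sum_nonneg fun x _ => ?_
    rw [mul_apply, map_sum]
    exact Finset.sum_nonneg fun y _ => hpos _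
  have hTcomm : ∀ X Y, T (X * Y) = T (Y * X) := fun X Y => by
    simp only [hT, mul_apply, map_sum]
    rw [Finset.sum_comm]
    exact Finset.sum_congr rfl fun x _ => Finset.sum_congr rfl fun y _ => hcomm _ _
  have hTf : ∀ X, T (f X) = trace X := fun X => by
    simp [hT, hf, trace, Algebra.algebraMap_eq_smul_one, hone]
  set e := Unitary.conjStarAlgAut ℝ (Matrix V V ℝ) U with he
  -- A gap below zero; any positive `δ` serves if no eigenvalue is negative.
  obtain ⟨δ, hδ, hδμ⟩ : ∃ δ : ℝ, 0 < δ ∧ ∀ i, μ i < 0 → δ ≤ -μ i := by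
    have h1 : ∀ᶠ δ in nhdsWithin (0 : ℝ) (Set.Ioi 0), ∀ i, μ i < 0 → δ ≤ -μ i := by
      refine Filter.eventually_all.2 fun i => ?_
      by_cases hi : μ i < 0
      · filter_upwards [Ioc_mem_nhdsGT (show (0 : ℝ) < -μ i by linarith)] with δ hδ _ using hδ.2
      · exact Filter.Eventually.of_forall fun δ h => absurd h hi
    obtain ⟨δ, h2, h3⟩ := (h1.and self_mem_nhdsWithin).exists
    exact ⟨δ, h3, h2⟩
  let M : ℝ := ∑ i, |μ i|
  have hM : 0 ≤ M := Finset.sum_nonneg fun i _ => abs_nonneg _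
  have hMμ : ∀ i, μ i ≤ M := fun i => (le_abs_self _).trans
    (Finset.single_le_sum (f := fun i => |μ i|) (fun i _ => abs_nonneg _) (Finset.mem_univ i))
  let φ : V → ℝ := fun i => if 0 ≤ μ i then 1 else 0
  -- Eigenvalues of `M F - δ (1 - F) - B`, which is therefore the square of `S`.
  let ν : V → ℝ := fun i => (M + δ) * φ i - δ - μ i
  have hν : ∀ i, 0 ≤ ν i := fun i => by
    by_cases hi : 0 ≤ μ i
    · simp only [ν, φ, hi, if_true]; linarith [hMμ i]
    · simp only [ν, φ, hi, if_false]; linarith [hδμ i (not_le.1 hi)]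
  let F : Matrix V V ℝ := e (diagonal φ)
  let S : Matrix V V ℝ := e (diagonal fun i => √(ν i))
  have hSS : star S * S = (M + δ) • F - δ • 1 - B := by
    rw [hB, ← map_star, ← map_mul, ← map_smul, ← map_one e, ← map_smul, ← map_sub, ← map_sub]
    congr 1
    rw [star_eq_conjTranspose, diagonal_conjTranspose, diagonal_mul_diagonal]
    ext i j
    by_cases hij : i = j
    · subst hij; simp [Real.mul_self_sqrt (hν i), ν]
    · simp [hij]
  have hF : IsStarProjection F := by
    refine IsStarProjection.map (f := e) ⟨?_, ?_⟩
    · rw [IsIdempotentElem, diagonal_mul_diagonal]; simp [φ]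
    · rw [IsSelfAdjoint, star_eq_conjTranspose, diagonal_conjTranspose]; simp
  have hfF : IsStarProjection (f F) :=
    ⟨by rw [IsIdempotentElem, ← map_mul, hF.isIdempotentElem.eq],
      by rw [IsSelfAdjoint, hfstar, hF.isSelfAdjoint.star_eq]⟩
  let P : Matrix V V 𝒜 := diagonal q
  have hP : IsStarProjection P :=
    ⟨by simp only [P, IsIdempotentElem, diagonal_mul_diagonal, (hq _).isIdempotentElem.eq],
      by
        rw [IsSelfAdjoint, star_eq_conjTranspose, diagonal_conjTranspose]
        congr 1; ext x; exact (hq x).isSelfAdjoint.star_eq⟩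
  let D : Matrix V V 𝒜 := diagonal fun x => √(B x x) • q x
  have hPBP : P * f B * P = star D * D := by
    rw [star_eq_conjTranspose, diagonal_conjTranspose, diagonal_mul_diagonal]
    ext x y
    rw [mul_diagonal, diagonal_mul, hf, ← Algebra.commutes, mul_assoc, ← Algebra.smul_def]
    by_cases hxy : x = y
    · subst hxy
      rw [diagonal_apply_eq, Pi.star_apply, star_smul, (hq x).isSelfAdjoint.star_eq,
        smul_mul_smul_comm, star_trivial, Real.mul_self_sqrt (hdiag x)]
    · rw [diagonal_apply_ne _ hxy]
      by_cases hb : B x y = 0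
      · rw [hb, zero_smul]
      · rw [horth x y hxy hb, smul_zero]
  have hmain : M • P - (M + δ) • (P - P * f F * P) = star D * D + star (f S * P) * (f S * P) := by
    have h1 : star (f S * P) * (f S * P) = P * f (star S * S) * P := by
      rw [star_mul, hfstar, hP.isSelfAdjoint.star_eq, map_mul]; simp only [mul_assoc]
    rw [h1, hSS, ← hPBP, map_sub, map_sub, map_smul, map_smul, map_one]
    simp only [mul_sub, sub_mul, mul_smul_comm, smul_mul_assoc, mul_one, hP.isIdempotentElem.eq]
    module
  have hfin := tracial_projection_le T hTpos hTcomm hP hfF hM hδ hmain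
  have htr : trace F = Nat.card {i // 0 ≤ μ i} := by
    have : trace F = trace (diagonal φ) := by
      simp only [F, he, Unitary.conjStarAlgAut_apply]
      rw [trace_mul_cycle]; simp
    rw [this, trace_diagonal, Nat.card_eq_fintype_card, Fintype.card_subtype]
    simp [φ]
  rw [hTf, htr, hT] at hfin
  simpa [P] using hfin

/-! ### Application to polynomials in the adjacency matrix -/

section Adjacency

variable {V : Type v} [Fintype V] [DecidableEq V] (G : SimpleGraph V)

/-- The entries of a polynomial of degree at most `k` in the adjacency matrix vanish beyond
distance `k`. -/
theorem edist_le_of_aeval_adjMatrix_ne_zero [DecidableRel G.Adj] {k : ℕ}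
    {p : Polynomial ℝ} (hp : p.natDegree ≤ k) {x y : V}
    (h : Polynomial.aeval (G.adjMatrix ℝ) p x y ≠ 0) : G.edist x y ≤ k := by
  rw [Polynomial.aeval_eq_sum_range, Matrix.sum_apply] at h
  obtain ⟨m, hm, h⟩ := Finset.exists_ne_zero_of_sum_ne_zero h
  rw [Matrix.smul_apply, SimpleGraph.adjMatrix_pow_apply_eq_card_walk, smul_eq_mul] at h
  have h2 : Fintype.card {w : G.Walk x y | w.length = m} ≠ 0 := fun h0 => h (by simp [h0])
  obtain ⟨⟨w, hw⟩⟩ := Fintype.card_pos_iff.1 (Nat.pos_of_ne_zero h2)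
  refine w.edist_le.trans ?_
  rw [show w.length = m from hw]
  exact_mod_cast (Nat.lt_succ_iff.1 (Finset.mem_range.1 hm)).trans hp

/-- A polynomial in the adjacency matrix is diagonalized by the eigenvectors of the graph. -/
theorem exists_aeval_adjMatrix_eq_conj_diagonal [DecidableRel G.Adj] :
    ∃ U : unitaryGroup V ℝ, ∀ p : Polynomial ℝ,
    Polynomial.aeval (G.adjMatrix ℝ) p =
      Unitary.conjStarAlgAut ℝ _ U (diagonal fun i => p.eval (adjEigenvalues G i)) := by
  have hA : (G.adjMatrix ℝ).IsHermitian :=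
    (conjTranspose_eq_transpose_of_trivial _).trans G.transpose_adjMatrix
  refine ⟨hA.eigenvectorUnitary, fun p => ?_⟩
  have h := hA.spectral_theorem
  have h2 : (RCLike.ofReal ∘ hA.eigenvalues : V → ℝ) = adjEigenvalues G := by
    ext i; rfl
  rw [h2] at h
  conv_lhs => rw [h]
  rw [Polynomial.aeval_algHom_apply]
  congr 1
  have h3 := Polynomial.aeval_algHom_apply (diagonalAlgHom (n := V) (α := ℝ) ℝ)
    (adjEigenvalues G) p
  rw [Polynomial.aeval_pi_apply] at h3
  simp only [Polynomial.coe_aeval_eq_eval] at h3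
  exact h3

variable {G} {k c : ℕ} {H : Type u} [NormedAddCommGroup H] [InnerProductSpace ℂ H] [CompleteSpace H]
  {P : V → Fin c → (H →L[ℂ] H)}

/-- The inertia bound for one matrix: if `B` vanishes beyond distance `k` and has nonnegative
diagonal, then a quantum `k`-distance coloring has at least `n / #{i : 0 ≤ μ i}` colors. -/
theorem IsQuantumDistColoring.card_le (hP : IsQuantumDistColoring G k c P)
    (U : unitaryGroup V ℝ) (μ : V → ℝ) (B : Matrix V V ℝ)
    (hB : B = Unitary.conjStarAlgAut ℝ _ U (diagonal μ)) (hdiag : ∀ x, 0 ≤ B x x)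
    (hdist : ∀ x y, x ≠ y → B x y ≠ 0 → G.edist x y ≤ k) :
    Fintype.card V ≤ c * Nat.card {i // 0 ≤ μ i} := by
  obtain ⟨τ, hτ⟩ := hP.tracial
  let q : V → Fin c → StarAlgebra.adjoin ℂ {T : H →L[ℂ] H | ∃ x h, T = P x h} := fun x h =>
    ⟨P x h, StarAlgebra.subset_adjoin ℂ _ ⟨x, h, rfl⟩⟩
  let σ : StarAlgebra.adjoin ℂ {T : H →L[ℂ] H | ∃ x h, T = P x h} →ₗ[ℝ] ℝ :=
    Complex.reLm ∘ₗ τ.restrictScalars ℝ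
  have hσ : ∀ a, σ a = (τ a).re := fun a => rfl
  have hcol : ∀ h, ∑ x, σ (q x h) ≤ Nat.card {i // 0 ≤ μ i} := fun h => by
    refine sum_tracial_le_card_nonneg σ ?_ ?_ ?_ U μ B hB hdiag (fun x => q x h) ?_ ?_
    · simp [hσ, hτ.map_one]
    · exact fun x => (Complex.le_def.1 (hτ.nonneg x)).1
    · exact fun x y => by rw [hσ, hσ, hτ.comm]
    · exact fun x => ⟨Subtype.ext (hP.proj x h).isIdempotentElem,
        Subtype.ext (hP.proj x h).isSelfAdjoint⟩
    · exact fun x y hxy hb => Subtype.ext (hP.orthogonal x y hxy (hdist x y hxy hb) h)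
  have hsum : ∀ x, ∑ h, q x h = 1 := fun x => Subtype.ext (by
    simpa [q] using hP.complete x)
  have htot : ∑ h, ∑ x, σ (q x h) = Fintype.card V := by
    rw [Finset.sum_comm]
    have h1 : ∀ x, ∑ h, σ (q x h) = 1 := fun x => by
      rw [← map_sum, hsum, hσ, hτ.map_one, Complex.one_re]
    simp [h1]
  have : (Fintype.card V : ℝ) ≤ c * Nat.card {i // 0 ≤ μ i} := by
    rw [← htot]
    exact (Finset.sum_le_sum fun h _ => hcol h).trans (by simp)
  exact_mod_cast this

/-- The inertia bound for a quantum `k`-distance coloring. -/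
theorem IsQuantumDistColoring.card_le_mul_inertiaCount [DecidableRel G.Adj]
    (hP : IsQuantumDistColoring G k c P) {p : Polynomial ℝ} (hp : p.natDegree ≤ k) :
    Fintype.card V ≤ c * inertiaCount G p := by
  obtain ⟨U, hU⟩ := exists_aeval_adjMatrix_eq_conj_diagonal G
  have hdist : ∀ r : ℝ, ∀ x y, x ≠ y →
      Polynomial.aeval (G.adjMatrix ℝ) (p - Polynomial.C r) x y ≠ 0 → G.edist x y ≤ k :=
    fun r x y _ h => edist_le_of_aeval_adjMatrix_ne_zero G
      ((Polynomial.natDegree_sub_C (a := r)).trans_le hp) h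
  have hentry : ∀ (r : ℝ) x, Polynomial.aeval (G.adjMatrix ℝ) (p - Polynomial.C r) x x =
      Polynomial.aeval (G.adjMatrix ℝ) p x x - r := fun r x => by
    simp [algebraMap_matrix_apply]
  rw [inertiaCount, ← Nat.mul_min_mul_left, le_min_iff]
  constructor
  · have := hP.card_le U _ _ (hU (p - Polynomial.C (minDiag G p))) (fun x => by
      rw [hentry, sub_nonneg]
      exact ciInf_le (Set.finite_range _).bddBelow x) (hdist _)
    simpa using this
  -- The sign is reversed so that the diagonal becomes `W(p) - p(A)_xx ≥ 0`.
  · have := hP.card_le U (fun i => -(p - Polynomial.C (maxDiag G p)).eval (adjEigenvalues G i))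
      (-Polynomial.aeval (G.adjMatrix ℝ) (p - Polynomial.C (maxDiag G p)))
      (by rw [hU, ← map_neg, diagonal_neg]) (fun x => by
        rw [Matrix.neg_apply, hentry, neg_sub, sub_nonneg]
        exact le_ciSup (f := fun x => Polynomial.aeval (G.adjMatrix ℝ) p x x)
          (Set.finite_range _).bddAbove x)
      (fun x y hxy h => hdist (maxDiag G p) x y hxy fun h0 =>
        h (by rw [Matrix.neg_apply, h0, neg_zero]))
    simpa using this

end Adjacency

open scoped ComplexOrder in
/-- Giving every vertex its own color is a quantum `k`-distance coloring in dimension one. -/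
theorem hasQuantumDistColoring_card {V : Type v} [Fintype V] (G : SimpleGraph V) (k : ℕ) :
    HasQuantumDistColoring.{u} G k (Fintype.card V) := by
  classical
  let ε := Fintype.equivFin V
  refine ⟨EuclideanSpace ℂ PUnit.{u + 1}, inferInstance, inferInstance, inferInstance,
    fun x h => if ε x = h then 1 else 0, ?_, ?_, ?_, ?_⟩
  · intro x h
    split_ifs
    · exact IsStarProjection.one _
    · exact IsStarProjection.zero _
  · intro x
    simp
  · intro x y hxy _ h
    by_cases h1 : ε x = h
    · have : ε y ≠ h := fun h2 => hxy (ε.injective (h1.trans h2.symm))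
      simp [this]
    · simp [h1]
  · let e₀ : EuclideanSpace ℂ PUnit.{u + 1} := EuclideanSpace.single PUnit.unit 1
    have he : ∀ w : EuclideanSpace ℂ PUnit.{u + 1}, w = w PUnit.unit • e₀ := fun w => by
      ext i; simp [e₀]
    let τ : (EuclideanSpace ℂ PUnit.{u + 1} →L[ℂ] EuclideanSpace ℂ PUnit.{u + 1}) →ₗ[ℂ] ℂ :=
      { toFun := fun S => S e₀ PUnit.unit
        map_add' := fun S R => by simp
        map_smul' := fun a S => by simp }
    -- In dimension one an operator is a scalar, so `τ` is a `*`-character and hence a trace.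
    have hmul : ∀ S R : EuclideanSpace ℂ PUnit.{u + 1} →L[ℂ] EuclideanSpace ℂ PUnit.{u + 1},
        τ (S * R) = τ S * τ R := fun S R => by
      change S (R e₀) PUnit.unit = _
      rw [he (R e₀), map_smul]
      simp [τ, mul_comm]
    have hstar : ∀ S : EuclideanSpace ℂ PUnit.{u + 1} →L[ℂ] EuclideanSpace ℂ PUnit.{u + 1},
        τ (star S) = star (τ S) := fun S => by
      have h1 := ContinuousLinearMap.adjoint_inner_right S e₀ e₀
      simp only [e₀, EuclideanSpace.inner_single_left, EuclideanSpace.inner_single_right] at h1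
      simpa [τ, ContinuousLinearMap.star_eq_adjoint, e₀] using h1
    refine ⟨τ ∘ₗ (StarSubalgebra.subtype _).toLinearMap, ?_, ?_, ?_⟩
    · simp [τ, e₀]
    · intro x
      rw [LinearMap.comp_apply]
      change _ ≤ τ (star x.1 * x.1)
      rw [hmul, hstar]
      exact star_mul_self_nonneg _
    · intro x y
      change τ (x.1 * y.1) = τ (y.1 * x.1)
      rw [hmul, hmul, mul_comm]

theorem mainTheorem6 {V : Type v} [Fintype V] [DecidableEq V] [Nonempty V]
    (G : SimpleGraph V) [DecidableRel G.Adj] (k : ℕ) (hk : 0 < k)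
    (p : Polynomial ℝ) (hp : p.natDegree ≤ k) :
    0 < inertiaCount G p ∧
      (Fintype.card V : ℝ) / (inertiaCount G p : ℝ) ≤
        (quantumDistChromaticNumber.{u} G k : ℝ) := by
  -- The infimum is attained only because some coloring exists; `sInf ∅` would be `0`.
  obtain ⟨H, _, _, _, P, hP⟩ :
      HasQuantumDistColoring.{u} G k (quantumDistChromaticNumber.{u} G k) :=
    Nat.sInf_mem (s := {c | HasQuantumDistColoring.{u} G k c}) ⟨_, hasQuantumDistColoring_card G k⟩
  have hle := hP.card_le_mul_inertiaCount hp
  have hpos : 0 < inertiaCount G p :=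
    Nat.pos_of_mul_pos_left (Fintype.card_pos.trans_le hle)
  refine ⟨hpos, (div_le_iff₀ (by exact_mod_cast hpos)).2 (by exact_mod_cast hle)⟩
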